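/- For integers $d,r,k\ge 1$ with $k\le r$, let $T(d,r,k)$ be the smallest positive integer $n$ such that for every list $a_1,\dots,a_n$ of (not necessarily distinct) points in $\mathbb{R}^d$ the index set $\{1,\dots,n\}$ can be partitioned into $r$ non-empty parts $N_1,\dots,N_r$ such that every $k$ of the $r$ convex hulls $\operatorname{conv}\{a_i : i\in N_j\}$ $(1\le j\le r)$ have a common point. Let $T(d,r)=(d+1)(r-1)+1$. Let $d\ge 3$ and $r\ge \lfloor\frac{d+3}{2}\rfloor$. Then $T\left(d,r,\lfloor\frac{d+3}{2}\rfloor\right)$ exists and $$T\left(d,r,\left\lfloor\tfrac{d+3}{2}\right\rfloor\right)=T(d,r)=(d+1)(r-1)+1 .$$ Moreover, let $p_0,\dots,p_d\in\mathbb{R}^d$ be the vertices of a $d$-simplex with $\sum_{i=0}^d p_i=0$, and let $X$ consist of $r-1$ distinct points chosen on each of the $d+1$ open rays $\{\lambda p_i:\lambda>0\}$, so that $|X|=(d+1)(r-1)$. Then in every partition of $X$ into $r$ non-empty parts there are $\lfloor\frac{d+3}{2}\rfloor$ parts whose convex hulls have empty common intersection. -/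

import Mathlib

/-- Given a family `a` of points indexed by `ι` and a division `c` of the index set into `r` parts
`N_j = {i | c i = j}`, every `k` of the `r` convex hulls `conv {a i : i ∈ N_j}` have a common
point. -/
def EveryHullsMeet {ι : Type*} {d r : ℕ} (k : ℕ) (a : ι → EuclideanSpace ℝ (Fin d))
    (c : ι → Fin r) : Prop :=
  ∀ s : Finset (Fin r), s.card = k →
    (⋂ j ∈ s, convexHull ℝ (a '' {i | c i = j})).Nonempty

/-- Every list of `n` points of `ℝ^d` (repetitions allowed) has an `r`-partition of its index set
such that every `k` of the `r` convex hulls have a common point. The partition is given by the map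
sending an index to its part; surjectivity says that the parts are non-empty. -/
def ReayProperty (d r k n : ℕ) : Prop :=
  ∀ a : Fin n → EuclideanSpace ℝ (Fin d),
    ∃ c : Fin n → Fin r, Function.Surjective c ∧ EveryHullsMeet k a c

/-- `T(d, r, k)`: the smallest positive integer `n` with the property above. -/
noncomputable def reayNumber (d r k : ℕ) : ℕ :=
  sInf {n : ℕ | 0 < n ∧ ReayProperty d r k n}

/-- The Tverberg number `T(d, r) = (d + 1)(r - 1) + 1` (used for `r ≥ 1`). -/
def tverbergNumber (d r : ℕ) : ℕ := (d + 1) * (r - 1) + 1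

/-! The upper bound is Tverberg's theorem, obtained by Sarkaria's tensor trick from colourful
Carathéodory. The lower bound comes from the points on rays. Suppose the hulls of the parts in a
family `T` share a point `z`. Each part writes `z` as a nonnegative combination of the `p i`, with a
zero coefficient on any ray it misses. Such an expression with a zero coefficient is unique, so all
parts of `T` that miss a ray share one coordinate vector `α`, which vanishes on every ray missed by
a member of `T`. If on all other rays `A` precedes `B`, then `A` needs more weight than `B` to reach
the same `α`; both total weights are 1, a contradiction (`iInter_convexHull_rays_eq_empty`). A small
`T` exists by counting (`exists_few_columns_cover_or_ordered`): a ray has fewer points than there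
are parts. Parts missing two new rays at once are taken greedily; averaging then yields `A` and `B`,
each with one point on every other remaining ray. Rays with the minority order cost one extra part
each. -/

/-- Membership in the convex hull of an indexed family, restricted to a set of indices, in terms
of weights that vanish off that set. -/
theorem mem_convexHull_image_iff_exists_weights {ι E : Type*} [Fintype ι] [AddCommGroup E]
    [Module ℝ E] (f : ι → E) (s : Set ι) (x : E) :
    x ∈ convexHull ℝ (f '' s) ↔
      ∃ w : ι → ℝ, (∀ i, 0 ≤ w i) ∧ (∀ i, i ∉ s → w i = 0) ∧ ∑ i, w i = 1 ∧
        ∑ i, w i • f i = x := by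
  classical
  constructor
  · intro hx
    let C : Set E := {x | ∃ w : ι → ℝ, (∀ i, 0 ≤ w i) ∧ (∀ i, i ∉ s → w i = 0) ∧
      ∑ i, w i = 1 ∧ ∑ i, w i • f i = x}
    have hC : Convex ℝ C := by
      rintro x ⟨w, w0, ws, w1, rfl⟩ y ⟨v, v0, vs, v1, rfl⟩ a b ha hb hab
      refine ⟨fun i => a * w i + b * v i, fun i => ?_, fun i hi => ?_, ?_, ?_⟩
      · have := w0 i
        have := v0 i
        positivity
      · simp [ws i hi, vs i hi]
      · rw [Finset.sum_add_distrib, ← Finset.mul_sum, ← Finset.mul_sum, w1, v1]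
        simpa using hab
      · simp only [add_smul, mul_smul, Finset.sum_add_distrib, Finset.smul_sum]
    have hsub : f '' s ⊆ C := by
      rintro _ ⟨i, hi, rfl⟩
      refine ⟨Pi.single i 1, fun j => ?_, fun j hj => ?_, ?_, ?_⟩
      · by_cases h : j = i
        · subst h; simp
        · simp [h]
      · have : j ≠ i := fun h => hj (h ▸ hi)
        simp [this]
      · simp
      · simp [Pi.single_apply]
    exact convexHull_min hsub hC hx
  · rintro ⟨w, w0, ws, w1, rfl⟩
    have hsupp : ∀ i, i ∉ Finset.univ.filter (· ∈ s) → w i = 0 := fun i hi => ws i (by simpa using hi)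
    rw [← Finset.sum_subset (Finset.subset_univ (Finset.univ.filter (· ∈ s)))
      (fun i _ hi => by simp [hsupp i hi])]
    refine (convex_convexHull ℝ _).sum_mem (fun i _ => w0 i) ?_ fun i hi =>
      subset_convexHull ℝ _ ⟨i, by simpa using hi, rfl⟩
    rw [Finset.sum_subset (Finset.subset_univ (Finset.univ.filter (· ∈ s)))
      (fun i _ hi => hsupp i hi), w1]

/-! ### Colourful Carathéodory via points of least norm -/

section ColourfulCaratheodory

variable {E : Type*} [NormedAddCommGroup E] [InnerProductSpace ℝ E]

open scoped RealInnerProductSpace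

/-- A nonempty finite set has a point of smallest norm in its convex hull. -/
theorem exists_norm_min_convexHull {s : Set E} (hs : s.Finite) (hne : s.Nonempty) :
    ∃ z ∈ convexHull ℝ s, ∀ y ∈ convexHull ℝ s, ‖z‖ ≤ ‖y‖ := by
  obtain ⟨z, hz, h⟩ := (hs.isCompact_convexHull (𝕜 := ℝ)).exists_isMinOn hne.convexHull
    continuous_norm.continuousOn
  exact ⟨z, hz, fun y hy => h hy⟩

/-- A point of smallest norm in a convex set `K` satisfies `⟪z, y⟫ ≥ ‖z‖²` for all `y ∈ K`. -/
theorem norm_sq_le_inner_of_norm_min {K : Set E} (hK : Convex ℝ K) {z : E} (hz : z ∈ K)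
    (h : ∀ y ∈ K, ‖z‖ ≤ ‖y‖) {y : E} (hy : y ∈ K) : ‖z‖ ^ 2 ≤ ⟪z, y⟫ := by
  by_contra! hlt
  set D := ‖z‖ ^ 2 - ⟪z, y⟫ with hD
  have hDpos : 0 < D := by linarith
  set Q := ‖y - z‖ ^ 2 with hQ
  have hQ0 : 0 ≤ Q := sq_nonneg _
  have key : ∀ e : ℝ, 0 ≤ e → e ≤ 1 → 0 ≤ e * (-2 * D + e * Q) := by
    intro e he he1
    have hmem : z + e • (y - z) ∈ K := hK.add_smul_sub_mem hz hy ⟨he, he1⟩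
    have h1 := h _ hmem
    have h2 : ‖z‖ ^ 2 ≤ ‖z + e • (y - z)‖ ^ 2 := by gcongr
    rw [norm_add_sq_real, inner_smul_right, inner_sub_right, real_inner_self_eq_norm_sq,
      norm_smul, mul_pow, Real.norm_eq_abs, sq_abs] at h2
    nlinarith
  -- Any step `e > 0` with `e * Q < 2 * D` would do; this one also satisfies `e ≤ 1` and allows `Q =
  -- 0`.
  have he := key (D / (D + Q)) (by positivity) (by rw [div_le_one (by positivity)]; linarith)
  have hpos : 0 < D / (D + Q) := by positivity
  have h3 := nonneg_of_mul_nonneg_right he hpos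
  have h4 : D / (D + Q) * Q ≤ D := by
    rw [div_mul_eq_mul_div, div_le_iff₀ (by positivity)]
    nlinarith
  linarith

variable [FiniteDimensional ℝ E]

/-- A point of smallest norm in the convex hull of finitely many points, if it is not `0`, is in
the convex hull of at most `finrank ℝ E` of them. -/
theorem exists_small_finset_of_norm_min {ι : Type*} [Fintype ι] (g : ι → E) {z : E}
    (hz : z ∈ convexHull ℝ (Set.range g)) (hmin : ∀ y ∈ convexHull ℝ (Set.range g), ‖z‖ ≤ ‖y‖)
    (hz0 : z ≠ 0) :
    ∃ t : Finset E, (t : Set E) ⊆ Set.range g ∧ z ∈ convexHull ℝ (t : Set E) ∧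
      t.card ≤ Module.finrank ℝ E := by
  have hle : ∀ i, ‖z‖ ^ 2 ≤ ⟪z, g i⟫ := fun i =>
    norm_sq_le_inner_of_norm_min (convex_convexHull ℝ _) hz hmin
      (subset_convexHull ℝ _ ⟨i, rfl⟩)
  have hzF : z ∈ convexHull ℝ (g '' {i | ⟪z, g i⟫ = ‖z‖ ^ 2}) := by
    rw [← Set.image_univ, mem_convexHull_image_iff_exists_weights] at hz
    obtain ⟨w, w0, -, w1, wz⟩ := hz
    rw [mem_convexHull_image_iff_exists_weights]
    refine ⟨w, w0, fun i hi => ?_, w1, wz⟩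
    have hsum : ∑ i, w i * (⟪z, g i⟫ - ‖z‖ ^ 2) = 0 := by
      have : ⟪z, ∑ i, w i • g i⟫ = ‖z‖ ^ 2 := by rw [wz, real_inner_self_eq_norm_sq]
      simp only [inner_sum, inner_smul_right] at this
      simp only [mul_sub, Finset.sum_sub_distrib, ← Finset.sum_mul, w1, this]
      ring
    have h0 := (Finset.sum_eq_zero_iff_of_nonneg
      (fun i _ => mul_nonneg (w0 i) (sub_nonneg.2 (hle i)))).1 hsum i (Finset.mem_univ i)
    exact (mul_eq_zero.1 h0).resolve_right fun h => hi (sub_eq_zero.1 h)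
  rw [convexHull_eq_union] at hzF
  simp only [Set.mem_iUnion] at hzF
  obtain ⟨t, htF, hind, hzt⟩ := hzF
  refine ⟨t, htF.trans (Set.image_subset_range _ _), hzt, ?_⟩
  have hcard := hind.card_le_finrank_succ
  -- The points used lie on a hyperplane orthogonal to `z`, which saves one point in Carathéodory's
  -- bound.
  have hspan : vectorSpan ℝ (Set.range ((↑) : t → E)) ≤ (ℝ ∙ z)ᗮ := by
    rw [vectorSpan_def, Submodule.span_le]
    rintro _ ⟨a, ⟨a, rfl⟩, b, ⟨b, rfl⟩, rfl⟩
    obtain ⟨i, hi, hia⟩ := htF a.2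
    obtain ⟨j, hj, hjb⟩ := htF b.2
    rw [SetLike.mem_coe, Submodule.mem_orthogonal_singleton_iff_inner_right]
    change ⟪z, (a : E) - b⟫ = 0
    rw [inner_sub_right, ← hia, ← hjb, hi, hj, sub_self]
  have h1 := Submodule.finrank_mono hspan
  have h2 := Submodule.finrank_add_finrank_orthogonal (ℝ ∙ z)
  rw [finrank_span_singleton hz0] at h2
  rw [Fintype.card_coe] at hcard
  omega

/-- **Colourful Carathéodory theorem**: given more than `finrank ℝ E` colour classes whose convex
hulls contain `0`, one may pick a point from each class so that `0` is in the convex hull of the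
points picked. -/
theorem exists_rainbow_zero_mem_convexHull {ι κ : Type*} [Fintype ι] [Finite κ] (f : ι → κ → E)
    (h0 : ∀ i, (0 : E) ∈ convexHull ℝ (Set.range (f i)))
    (hcard : Module.finrank ℝ E < Fintype.card ι) :
    ∃ c : ι → κ, (0 : E) ∈ convexHull ℝ (Set.range fun i => f i (c i)) := by
  classical
  have hι : Nonempty ι := Fintype.card_pos_iff.1 (by omega)
  have hκ : Nonempty κ := by
    have : (Set.range (f hι.some)).Nonempty := convexHull_nonempty_iff.1 ⟨0, h0 _⟩
    exact Set.range_nonempty_iff_nonempty.1 this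
  choose z hz hmin using fun c : ι → κ =>
    exists_norm_min_convexHull (Set.finite_range fun i => f i (c i)) (Set.range_nonempty _)
  obtain ⟨c, hc⟩ := Finite.exists_min fun c => ‖z c‖
  refine ⟨c, ?_⟩
  by_cases hzc : z c = 0
  · exact hzc ▸ hz c
  exfalso
  obtain ⟨t, htr, hzt, htc⟩ := exists_small_finset_of_norm_min _ (hz c) (hmin c) hzc
  choose! u hu using fun y (hy : y ∈ t) => htr hy
  -- Some colour is not needed to represent `z c`, so its point can be exchanged freely.
  obtain ⟨i₀, hi₀⟩ : ∃ i, i ∉ t.image u := by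
    by_contra! h
    have h1 : Fintype.card ι ≤ (t.image u).card := by
      rw [← Finset.card_univ]
      exact Finset.card_le_card fun i _ => h i
    have := Finset.card_image_le (s := t) (f := u)
    omega
  obtain ⟨j, hj⟩ : ∃ j, ⟪z c, f i₀ j⟫ ≤ 0 := by
    by_contra! h
    have hconv : Convex ℝ {y : E | 0 < ⟪z c, y⟫} :=
      convex_halfSpace_gt (f := fun y => ⟪z c, y⟫)
        ⟨fun x y => inner_add_right _ _ _, fun a x => by simp [inner_smul_right]⟩ 0
    have := convexHull_min (t := {y : E | 0 < ⟪z c, y⟫}) (by rintro _ ⟨j, rfl⟩; exact h j) hconv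
      (h0 i₀)
    simp at this
  let c' := Function.update c i₀ j
  have hsub : (t : Set E) ⊆ Set.range fun i => f i (c' i) := by
    intro y hy
    refine ⟨u y, ?_⟩
    have hne : u y ≠ i₀ := fun h => hi₀ (Finset.mem_image.2 ⟨y, hy, h⟩)
    simpa [c', hne] using hu y hy
  have hmem : f i₀ j ∈ Set.range fun i => f i (c' i) := ⟨i₀, by simp [c']⟩
  -- After the exchange `z c` is still in the hull and still of least norm, so the new point should
  -- have positive inner product with it.
  have := norm_sq_le_inner_of_norm_min (convex_convexHull ℝ _) (convexHull_mono hsub hzt)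
    (fun y hy => (hc c').trans (hmin c' y hy)) (subset_convexHull ℝ _ hmem)
  have : 0 < ‖z c‖ := norm_pos_iff.2 hzc
  nlinarith

end ColourfulCaratheodory

/-! ### Tverberg's theorem by Sarkaria's method -/

/-- **Tverberg's theorem**: `(d + 1) s + 1` points of `ℝ^d` can be divided into `s + 1` parts whose
convex hulls have a common point. -/
theorem exists_tverberg_partition {ι : Type*} [Fintype ι] {d s : ℕ}
    (hι : (d + 1) * s < Fintype.card ι) (a : ι → EuclideanSpace ℝ (Fin d)) :
    ∃ c : ι → Fin (s + 1), (⋂ j, convexHull ℝ (a '' {i | c i = j})).Nonempty := by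
  classical
  -- `b` appends a coordinate 1 to each point. The vectors `v j` are the standard basis and minus
  -- its sum, whose only linear relations have equal coefficients; `f i j` is `v j ⊗ b i`.
  let b : ι → Option (Fin d) → ℝ := fun i l => l.elim 1 (a i)
  let v : Fin (s + 1) → Fin s → ℝ := fun j m =>
    (if j = m.castSucc then 1 else 0) - (if j = Fin.last s then 1 else 0)
  let f : ι → Fin (s + 1) → EuclideanSpace ℝ (Fin s × Option (Fin d)) := fun i j =>
    WithLp.toLp 2 fun x => v j x.1 * b i x.2
  have hv : ∀ m, ∑ j, v j m = 0 := fun m => by simp [v]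
  obtain ⟨c, hc⟩ := exists_rainbow_zero_mem_convexHull f (fun i => by
      rw [← Set.image_univ, mem_convexHull_image_iff_exists_weights]
      refine ⟨fun _ => ((s + 1 : ℕ) : ℝ)⁻¹, fun _ => by positivity, by simp, ?_, ?_⟩
      · rw [Finset.sum_const, Finset.card_univ, Fintype.card_fin, nsmul_eq_mul]
        exact mul_inv_cancel₀ (by positivity)
      · ext x
        simp [f, ← Finset.mul_sum, ← Finset.sum_mul, hv])
    (by simpa [mul_comm] using hι)
  rw [← Set.image_univ, mem_convexHull_image_iff_exists_weights] at hc
  obtain ⟨w, w0, -, w1, wz⟩ := hc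
  have hpart : ∀ j l, ∑ i with c i = j, w i * b i l = ∑ i with c i = Fin.last s, w i * b i l := by
    intro j l
    induction j using Fin.lastCases with
    | last => rfl
    | cast m =>
      have h := congrArg (fun y : EuclideanSpace ℝ (Fin s × Option (Fin d)) => y (m, l)) wz
      simp only [f, v, WithLp.ofLp_sum, WithLp.ofLp_smul, Finset.sum_apply, Pi.smul_apply,
        smul_eq_mul, PiLp.zero_apply] at h
      rw [Finset.sum_filter, Finset.sum_filter, ← sub_eq_zero, ← Finset.sum_sub_distrib]
      refine (Finset.sum_congr rfl fun i _ => ?_).trans h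
      split_ifs <;> ring
  set W := ∑ i with c i = Fin.last s, w i with hW
  have hWj : ∀ j, ∑ i with c i = j, w i = W := fun j => by simpa [b] using hpart j none
  have hWpos : 0 < W := by
    have h1 : ∑ j, ∑ i with c i = j, w i = 1 := by rw [Finset.sum_fiberwise, w1]
    simp only [hWj, Finset.sum_const, Finset.card_univ, Fintype.card_fin, nsmul_eq_mul] at h1
    by_contra! hle
    have : ((s + 1 : ℕ) : ℝ) * W ≤ 0 := mul_nonpos_of_nonneg_of_nonpos (by positivity) hle
    linarith
  refine ⟨c, W⁻¹ • ∑ i with c i = Fin.last s, w i • a i, Set.mem_iInter.2 fun j => ?_⟩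
  rw [mem_convexHull_image_iff_exists_weights]
  refine ⟨fun i => if c i = j then W⁻¹ * w i else 0, fun i => ?_, fun i hi => if_neg hi, ?_, ?_⟩
  · have := w0 i
    dsimp only
    split_ifs <;> positivity
  · rw [← Finset.sum_filter, ← Finset.mul_sum, hWj, inv_mul_cancel₀ hWpos.ne']
  · ext l
    have h := hpart j (some l)
    simp only [b, Option.elim] at h
    simp only [ite_smul, zero_smul, ← Finset.sum_filter, mul_smul, ← Finset.smul_sum]
    simp only [WithLp.ofLp_sum, WithLp.ofLp_smul, Finset.sum_apply, Pi.smul_apply, smul_eq_mul, h]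

/-! ### Choosing few parts from the table of point counts -/

section Counting

variable {I κ : Type*}

/-- If each row of a table `n` of naturals has sum less than the number of columns, and no column
has two zeros within the set `R` of rows, then some column has exactly one zero within `R` and all
its other entries within `R` are `1`. -/
theorem exists_column_eq_one_of_ne [Fintype κ] {n : I → κ → ℕ}
    (hn : ∀ i, ∑ j, n i j < Fintype.card κ) {R : Finset I} (hR : R.Nonempty)
    (huniq : ∀ j, ∀ i ∈ R, ∀ i' ∈ R, n i j = 0 → n i' j = 0 → i = i') :
    ∃ j, ∃ i ∈ R, n i j = 0 ∧ ∀ i' ∈ R, i' ≠ i → n i' j = 1 := by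
  classical
  obtain ⟨j, -, hj⟩ : ∃ j ∈ Finset.univ, ∑ i ∈ R, n i j < R.card := by
    apply Finset.exists_lt_of_sum_lt
    rw [Finset.sum_comm, Finset.sum_const, Finset.card_univ, smul_eq_mul, mul_comm, ← smul_eq_mul,
      ← Finset.sum_const]
    exact Finset.sum_lt_sum_of_nonempty hR fun i _ => hn i
  obtain ⟨i, hi, hij⟩ : ∃ i ∈ R, n i j = 0 := by
    by_contra! h
    have : ∑ i ∈ R, 1 ≤ ∑ i ∈ R, n i j :=
      Finset.sum_le_sum fun i hi => Nat.one_le_iff_ne_zero.2 (h i hi)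
    rw [← Finset.card_eq_sum_ones] at this
    omega
  -- Off row `i` the entries are at least 1 and sum to at most `R.card - 1`, so each is 1.
  refine ⟨j, i, hi, hij, fun i' hi' hne => ?_⟩
  have hpos : ∀ x ∈ R.erase i, 1 ≤ n x j := fun x hx => by
    rw [Finset.mem_erase] at hx
    exact Nat.one_le_iff_ne_zero.2 fun h => hx.1 (huniq j x hx.2 i hi h hij)
  have hmem : i' ∈ R.erase i := Finset.mem_erase.2 ⟨hne, hi'⟩
  have h1 := Finset.add_sum_erase R (fun x => n x j) hi
  have h2 := Finset.add_sum_erase (R.erase i) (fun x => n x j) hmem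
  have h3 : ((R.erase i).erase i').card ≤ ∑ x ∈ (R.erase i).erase i', n x j := by
    rw [Finset.card_eq_sum_ones]
    exact Finset.sum_le_sum fun x hx => hpos x (Finset.mem_of_mem_erase hx)
  have h4 := Finset.card_erase_add_one hi
  have h5 := Finset.card_erase_add_one hmem
  have := hpos i' hmem
  omega

variable [Fintype I] [Fintype κ]

/-- There is a set of columns whose zeros cover at least twice as many rows as it has columns,
such that no further column has two zeros in the rows left over. -/
theorem exists_saturated_columns [DecidableEq κ] (n : I → κ → ℕ) :
    ∃ (J : Finset κ) (R : Finset I), 2 * J.card + R.card ≤ Fintype.card I ∧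
      (∀ i, i ∉ R → ∃ j ∈ J, n i j = 0) ∧
      ∀ j, ∀ i ∈ R, ∀ i' ∈ R, n i j = 0 → n i' j = 0 → i = i' := by
  classical
  let R : Finset κ → Finset I := fun J => Finset.univ.filter fun i => ∀ j ∈ J, n i j ≠ 0
  obtain ⟨J, hJ, hmax⟩ := Finset.exists_max_image
    (Finset.univ.filter fun J : Finset κ => 2 * J.card + (R J).card ≤ Fintype.card I) Finset.card
    ⟨∅, by simp [R]⟩
  rw [Finset.mem_filter] at hJ
  refine ⟨J, R J, hJ.2, fun i hi => ?_, fun j i hi i' hi' h h' => ?_⟩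
  · by_contra! hcon
    exact hi (Finset.mem_filter.2 ⟨Finset.mem_univ _, hcon⟩)
  · by_contra hne
    have hjJ : j ∉ J := fun hj => (Finset.mem_filter.1 hi).2 j hj h
    -- A column with two zeros in `R J` removes two rows, so adding it keeps the inequality and
    -- contradicts maximality.
    have hsub : R (insert j J) ⊆ ((R J).erase i).erase i' := by
      intro x hx
      have hx' := (Finset.mem_filter.1 hx).2
      have hxj : n x j ≠ 0 := hx' j (Finset.mem_insert_self _ _)
      refine Finset.mem_erase.2 ⟨fun e => hxj (e ▸ h'), Finset.mem_erase.2 ⟨fun e => hxj (e ▸ h),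
        Finset.mem_filter.2 ⟨Finset.mem_univ _, fun y hy => hx' y (Finset.mem_insert_of_mem hy)⟩⟩⟩
    have h1 := Finset.card_le_card hsub
    have h2 := Finset.card_erase_add_one hi
    have h3 := Finset.card_erase_add_one (Finset.mem_erase.2 ⟨Ne.symm hne, hi'⟩)
    have h4 := Finset.card_insert_of_notMem hjJ
    have h5 := hmax (insert j J) (Finset.mem_filter.2 ⟨Finset.mem_univ _, by omega⟩)
    omega

/-- In a table of naturals whose rows have sums less than the number of columns, with a relation
`P j j' i` that compares any two entries `1` of a row, there are a set `T` of few columns and two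
columns `A`, `B` in it such that each row has a zero in `T` or satisfies `P A B`. -/
theorem exists_few_columns_cover_or_ordered [Nonempty I] (n : I → κ → ℕ)
    (hn : ∀ i, ∑ j, n i j < Fintype.card κ) (P : κ → κ → I → Prop)
    (hP : ∀ A B i, A ≠ B → n i A = 1 → n i B = 1 → P A B i ∨ P B A i) :
    ∃ T : Finset κ, T.card ≤ (Fintype.card I + 2) / 2 ∧ ∃ A ∈ T, ∃ B ∈ T,
      (∃ i, n i A = 0) ∧ (∃ i, n i B = 0) ∧ ∀ i, (∃ j ∈ T, n i j = 0) ∨ P A B i := by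
  classical
  have hzero : ∀ i, ∃ j, n i j = 0 := by
    intro i
    obtain ⟨j, i', hi', hj, -⟩ := exists_column_eq_one_of_ne hn (Finset.singleton_nonempty i)
      (by simp +contextual)
    exact ⟨j, Finset.mem_singleton.1 hi' ▸ hj⟩
  choose q hq using hzero
  obtain ⟨J, R, hcard, hcov, huniq⟩ := exists_saturated_columns n
  by_cases hR : R.card ≤ 1
  · have hT : ∀ i, ∃ j ∈ J ∪ R.image q, n i j = 0 := by
      intro i
      by_cases hi : i ∈ R
      · exact ⟨q i, Finset.mem_union_right _ (Finset.mem_image_of_mem _ hi), hq i⟩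
      · obtain ⟨j, hj, h⟩ := hcov i hi
        exact ⟨j, Finset.mem_union_left _ hj, h⟩
    obtain ⟨i₀⟩ := ‹Nonempty I›
    obtain ⟨A, hA, hA0⟩ := hT i₀
    refine ⟨J ∪ R.image q, ?_, A, hA, A, hA, ⟨i₀, hA0⟩, ⟨i₀, hA0⟩, fun i => Or.inl (hT i)⟩
    have := Finset.card_union_le J (R.image q)
    have := Finset.card_image_le (s := R) (f := q)
    omega
  push Not at hR
  obtain ⟨A, iA, hiA, hA0, hA1⟩ := exists_column_eq_one_of_ne hn
    (Finset.card_pos.1 (by omega : 0 < R.card)) huniq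
  have hcA := Finset.card_erase_add_one hiA
  obtain ⟨B, iB, hiB, hB0, hB1⟩ := exists_column_eq_one_of_ne hn
    (Finset.card_pos.1 (by omega : 0 < (R.erase iA).card)) fun j i hi i' hi' =>
      huniq j i (Finset.mem_of_mem_erase hi) i' (Finset.mem_of_mem_erase hi')
  have hcB := Finset.card_erase_add_one hiB
  set R' := (R.erase iA).erase iB with hR'
  have hAB : A ≠ B := by
    rintro rfl
    have := hA1 iB (Finset.mem_of_mem_erase hiB) (Finset.ne_of_mem_erase hiB)
    omega
  -- `M` is the set of badly ordered rows, each paid for by one column. The size is at most `J.card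
  -- + 2 + R'.card / 2`, where `2 * J.card + R'.card + 2 ≤ card I`.
  have key : ∀ A' B', A' ∈ ({A, B} : Finset κ) → B' ∈ ({A, B} : Finset κ) → ∀ M ⊆ R',
      2 * M.card ≤ R'.card → (∀ i ∈ R', i ∉ M → P A' B' i) →
      ∃ T : Finset κ, T.card ≤ (Fintype.card I + 2) / 2 ∧ ∃ A ∈ T, ∃ B ∈ T,
        (∃ i, n i A = 0) ∧ (∃ i, n i B = 0) ∧ ∀ i, (∃ j ∈ T, n i j = 0) ∨ P A B i := by
    intro A' B' hA' hB' M hM hMc hPM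
    have hz : ∀ j ∈ ({A, B} : Finset κ), ∃ i, n i j = 0 := by
      simpa using ⟨⟨iA, hA0⟩, ⟨iB, hB0⟩⟩
    refine ⟨(J ∪ {A, B}) ∪ M.image q, ?_,
      A', Finset.mem_union_left _ (Finset.mem_union_right _ hA'),
      B', Finset.mem_union_left _ (Finset.mem_union_right _ hB'), hz A' hA', hz B' hB',
      fun i => ?_⟩
    · have := Finset.card_union_le (J ∪ {A, B}) (M.image q)
      have := Finset.card_union_le J {A, B}
      have := Finset.card_image_le (s := M) (f := q)
      have := Finset.card_le_two (a := A) (b := B)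
      omega
    · by_cases hiR : i ∈ R
      · by_cases h1 : i = iA
        · exact Or.inl ⟨A, by simp, h1 ▸ hA0⟩
        by_cases h2 : i = iB
        · exact Or.inl ⟨B, by simp, h2 ▸ hB0⟩
        by_cases h3 : i ∈ M
        · exact Or.inl ⟨q i, Finset.mem_union_right _ (Finset.mem_image_of_mem _ h3), hq i⟩
        · exact Or.inr (hPM i (Finset.mem_erase.2 ⟨h2, Finset.mem_erase.2 ⟨h1, hiR⟩⟩) h3)
      · obtain ⟨j, hj, h⟩ := hcov i hiR
        exact Or.inl ⟨j, by simp [hj], h⟩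
  have hcmp : ∀ i ∈ R', P A B i ∨ P B A i := by
    intro i hi
    have h1 := Finset.mem_of_mem_erase hi
    exact hP A B i hAB (hA1 i (Finset.mem_of_mem_erase h1) (Finset.ne_of_mem_erase h1))
      (hB1 i h1 (Finset.ne_of_mem_erase hi))
  have hsplit := Finset.card_filter_add_card_filter_not (s := R') (fun i => P A B i)
  by_cases hc : 2 * (R'.filter fun i => P A B i).card ≤ R'.card
  · exact key B A (by simp) (by simp) _ (Finset.filter_subset _ _) hc fun i hi hi' =>
      (hcmp i hi).resolve_left fun h => hi' (Finset.mem_filter.2 ⟨hi, h⟩)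
  · refine key A B (by simp) (by simp) _
      (Finset.filter_subset (fun i => ¬ P A B i) _) (by omega) fun i hi hi' => ?_
    by_contra h
    exact hi' (Finset.mem_filter.2 ⟨hi, h⟩)

end Counting

/-! ### Hulls of points on the rays of a simplex -/

section Rays

variable {E I X κ : Type*} [AddCommGroup E] [Module ℝ E] [Fintype I] [Fintype X]

/-- Two nonnegative coordinate vectors of a point with respect to the vertices of a simplex with
centre `0` agree if each of them has a zero coordinate. -/
theorem AffineIndependent.eq_of_sum_smul_eq {p : I → E} (hp : AffineIndependent ℝ p)
    (hp0 : ∑ i, p i = 0) {α β : I → ℝ} (hα : ∀ i, 0 ≤ α i) (hβ : ∀ i, 0 ≤ β i)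
    (hα0 : ∃ i, α i = 0) (hβ0 : ∃ i, β i = 0) (h : ∑ i, α i • p i = ∑ i, β i • p i) : α = β := by
  obtain ⟨i, hi⟩ := hα0
  obtain ⟨i', hi'⟩ := hβ0
  have hI : (Fintype.card I : ℝ) ≠ 0 := by
    have : Nonempty I := ⟨i⟩
    exact_mod_cast Fintype.card_ne_zero
  set e := (∑ j, (α j - β j)) / Fintype.card I with he
  -- Subtracting the mean gives coefficients of sum 0, to which affine independence applies; the
  -- zeros of `α` and `β` then force `e ≤ 0` and `e ≥ 0`.
  have hconst : ∀ j, α j - β j = e := by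
    intro j
    have := affineIndependent_iff.1 hp Finset.univ (fun j => α j - β j - e) ?_ ?_ j
      (Finset.mem_univ j)
    · linarith
    · rw [Finset.sum_sub_distrib, Finset.sum_const, Finset.card_univ, nsmul_eq_mul, he,
        mul_div_cancel₀ _ hI, sub_self]
    · simp only [sub_smul, Finset.sum_sub_distrib, h, ← Finset.smul_sum, hp0]
      simp
  have h1 := hconst i
  have h2 := hconst i'
  have h3 := hβ i
  have h4 := hα i'
  funext j
  have h5 := hconst j
  linarith

/-- Points `t x • p (ρ x)` on the rays through the vertices of a simplex with centre `0` are
divided into parts `c`. If `A` and `B` are parts of the family `T` that both miss a ray, and on each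
ray that no part in `T` misses, the points of `A` precede those of `B`, then the convex hulls of the
parts in `T` have no common point. -/
theorem iInter_convexHull_rays_eq_empty {p : I → E} (hp : AffineIndependent ℝ p)
    (hp0 : ∑ i, p i = 0) (ρ : X → I) {t : X → ℝ} (ht : ∀ x, 0 < t x) (c : X → κ) {T : Finset κ}
    {A B : κ} (hA : A ∈ T) (hB : B ∈ T) (hA0 : ∃ i, ∀ x, ρ x = i → c x ≠ A)
    (hB0 : ∃ i, ∀ x, ρ x = i → c x ≠ B)
    (h : ∀ i, (∃ j ∈ T, ∀ x, ρ x = i → c x ≠ j) ∨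
      ∀ x y, ρ x = i → ρ y = i → c x = A → c y = B → t x < t y) :
    (⋂ j ∈ T, convexHull ℝ ((fun x => t x • p (ρ x)) '' {x | c x = j})) = ∅ := by
  classical
  rw [Set.eq_empty_iff_forall_notMem]
  intro z hz
  simp only [Set.mem_iInter, mem_convexHull_image_iff_exists_weights, Set.mem_ofPred_eq] at hz
  choose! w w0 wc w1 wz using hz
  let α : κ → I → ℝ := fun j i => ∑ x with ρ x = i, w j x * t x
  have hα0 : ∀ j ∈ T, ∀ i, 0 ≤ α j i := fun j hj i =>
    Finset.sum_nonneg fun x _ => mul_nonneg (w0 j hj x) (ht x).le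
  have hαz : ∀ j ∈ T, ∑ i, α j i • p i = z := by
    intro j hj
    rw [← wz j hj, ← Finset.sum_fiberwise _ ρ]
    refine Finset.sum_congr rfl fun i _ => ?_
    rw [Finset.sum_smul]
    refine Finset.sum_congr rfl fun x hx => ?_
    rw [(Finset.mem_filter.1 hx).2, mul_smul]
  have hαmiss : ∀ j ∈ T, ∀ i, (∀ x, ρ x = i → c x ≠ j) → α j i = 0 := fun j hj i hi =>
    Finset.sum_eq_zero fun x hx => by
      rw [wc j hj x (hi x (Finset.mem_filter.1 hx).2), zero_mul]
  have hαA : ∀ j ∈ T, (∃ i, ∀ x, ρ x = i → c x ≠ j) → α j = α A := by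
    rintro j hj ⟨i, hi⟩
    obtain ⟨i', hi'⟩ := hA0
    exact hp.eq_of_sum_smul_eq hp0 (hα0 j hj) (hα0 A hA) ⟨i, hαmiss j hj i hi⟩
      ⟨i', hαmiss A hA i' hi'⟩ ((hαz j hj).trans (hαz A hA).symm)
  have hαB : α B = α A := hαA B hB hB0
  let W : κ → I → ℝ := fun j i => ∑ x with ρ x = i, w j x
  have hW1 : ∀ j ∈ T, ∑ i, W j i = 1 := fun j hj => by
    rw [← w1 j hj]
    exact Finset.sum_fiberwise _ _ _
  have hW0 : ∀ j ∈ T, ∀ i, 0 ≤ W j i := fun j hj i => Finset.sum_nonneg fun x _ => w0 j hj x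
  have hWα : ∀ j ∈ T, ∀ i, α j i = 0 → W j i = 0 := fun j hj i hi =>
    Finset.sum_eq_zero fun x hx => by
      have := (Finset.sum_eq_zero_iff_of_nonneg
        (fun x _ => mul_nonneg (w0 j hj x) (ht x).le)).1 hi x hx
      exact (mul_eq_zero.1 this).resolve_right (ht x).ne'
  have hWpos : ∀ j ∈ T, ∀ i, 0 < α j i → 0 < W j i := by
    intro j hj i hi
    refine (hW0 j hj i).lt_of_ne fun h0 => hi.ne' ?_
    have hz := (Finset.sum_eq_zero_iff_of_nonneg (fun x _ => w0 j hj x)).1 h0.symm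
    exact Finset.sum_eq_zero fun x hx => by rw [hz x hx, zero_mul]
  -- on each ray the weight of `B` is at most that of `A`, strictly less if it is positive
  have hlt : ∀ i, 0 < α A i → W B i < W A i := by
    intro i hi
    rcases h i with ⟨j, hj, hm⟩ | hord
    · have h1 := hαmiss j hj i hm
      rw [hαA j hj ⟨i, hm⟩] at h1
      exact absurd h1 hi.ne'
    -- This double sum compares the mean positions of `A` and `B` on the ray without dividing by
    -- their weights.
    have hprod : 0 < ∑ x with ρ x = i, ∑ y with ρ y = i, w A x * w B y * (t y - t x) := by
      have hnn : ∀ x ∈ Finset.univ.filter (ρ · = i), ∀ y ∈ Finset.univ.filter (ρ · = i),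
          0 ≤ w A x * w B y * (t y - t x) := by
        intro x hx y hy
        by_cases hxA : c x = A
        · by_cases hyB : c y = B
          · exact mul_nonneg (mul_nonneg (w0 A hA x) (w0 B hB y)) (sub_nonneg.2
              (hord x y (Finset.mem_filter.1 hx).2 (Finset.mem_filter.1 hy).2 hxA hyB).le)
          · simp [wc B hB y hyB]
        · simp [wc A hA x hxA]
      have hex : ∀ j ∈ T, 0 < W j i → ∃ x ∈ Finset.univ.filter (ρ · = i), 0 < w j x := by
        intro j hj hpos
        by_contra! hcon
        exact hpos.not_ge (Finset.sum_nonpos hcon)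
      obtain ⟨x, hx, hwx⟩ := hex A hA (hWpos A hA i hi)
      obtain ⟨y, hy, hwy⟩ := hex B hB (hWpos B hB i (hαB ▸ hi))
      refine Finset.sum_pos' (fun x hx => Finset.sum_nonneg (hnn x hx)) ⟨x, hx, ?_⟩
      refine Finset.sum_pos' (hnn x hx) ⟨y, hy, mul_pos (mul_pos hwx hwy) (sub_pos.2 ?_)⟩
      refine hord x y (Finset.mem_filter.1 hx).2 (Finset.mem_filter.1 hy).2 ?_ ?_
      · by_contra hne
        exact hwx.ne' (wc A hA x hne)
      · by_contra hne
        exact hwy.ne' (wc B hB y hne)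
    have heq : ∑ x with ρ x = i, ∑ y with ρ y = i, w A x * w B y * (t y - t x)
        = W A i * α B i - α A i * W B i := by
      simp only [W, α, Finset.sum_mul_sum, ← Finset.sum_sub_distrib]
      refine Finset.sum_congr rfl fun x _ => Finset.sum_congr rfl fun y _ => ?_
      ring
    rw [heq, hαB, mul_comm (α A i), ← sub_mul] at hprod
    exact sub_pos.1 (pos_of_mul_pos_left hprod hi.le)
  have hle : ∀ i, W B i ≤ W A i := by
    intro i
    rcases (hα0 A hA i).eq_or_lt with h0 | hpos
    · rw [hWα A hA i h0.symm, hWα B hB i (by rw [hαB, ← h0])]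
    · exact (hlt i hpos).le
  obtain ⟨i, hi⟩ : ∃ i, 0 < α A i := by
    by_contra! hcon
    have := hW1 A hA
    rw [Finset.sum_eq_zero fun i _ => hWα A hA i ((hcon i).antisymm (hα0 A hA i))] at this
    exact zero_ne_one this
  have := Finset.sum_lt_sum (fun i _ => hle i) ⟨i, Finset.mem_univ i, hlt i hi⟩
  rw [hW1 A hA, hW1 B hB] at this
  exact lt_irrefl _ this

end Rays

/-- `r - 1` distinct points on each of the rays from the centre `0` of a `d`-simplex to its
vertices: in every division into `r` parts, some `⌊(d + 3) / 2⌋` parts have convex hulls with no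
common point. -/
theorem exists_iInter_convexHull_rays_eq_empty {d r : ℕ} (hr : (d + 3) / 2 ≤ r)
    {p : Fin (d + 1) → EuclideanSpace ℝ (Fin d)} (hp : AffineIndependent ℝ p)
    (hp0 : ∑ i, p i = 0) {t : Fin (d + 1) → Fin (r - 1) → ℝ} (ht : ∀ i m, 0 < t i m)
    (hinj : ∀ i, Function.Injective (t i)) (c : Fin (d + 1) × Fin (r - 1) → Fin r) :
    ∃ s : Finset (Fin r), s.card = (d + 3) / 2 ∧
      (⋂ j ∈ s, convexHull ℝ
        ((fun x : Fin (d + 1) × Fin (r - 1) => t x.1 x.2 • p x.1) '' {x | c x = j})) = ∅ := by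
  classical
  let n : Fin (d + 1) → Fin r → ℕ := fun i j => (Finset.univ.filter fun m => c (i, m) = j).card
  have hn : ∀ i, ∑ j, n i j < Fintype.card (Fin r) := by
    intro i
    rw [← Finset.card_eq_sum_card_fiberwise (s := Finset.univ) (f := fun m => c (i, m))
      (fun m _ => Finset.mem_coe.2 (Finset.mem_univ _)), Finset.card_univ, Fintype.card_fin,
      Fintype.card_fin]
    omega
  have hmiss : ∀ i j, n i j = 0 → ∀ x : Fin (d + 1) × Fin (r - 1), x.1 = i → c x ≠ j := by
    rintro i j h ⟨_, m⟩ rfl hc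
    rw [Finset.card_eq_zero, Finset.filter_eq_empty_iff] at h
    exact h (Finset.mem_univ m) hc
  obtain ⟨T, hT, A, hA, B, hB, ⟨iA, hA0⟩, ⟨iB, hB0⟩, hcov⟩ :=
    exists_few_columns_cover_or_ordered n hn
      (fun A B i => ∀ m m', c (i, m) = A → c (i, m') = B → t i m < t i m') (by
        intro A B i hAB h1 h2
        obtain ⟨a, ha⟩ := Finset.card_eq_one.1 h1
        obtain ⟨b, hb⟩ := Finset.card_eq_one.1 h2
        have ha' : ∀ m, c (i, m) = A ↔ m = a := fun m => by
          simpa using Finset.ext_iff.1 ha m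
        have hb' : ∀ m, c (i, m) = B ↔ m = b := fun m => by
          simpa using Finset.ext_iff.1 hb m
        have hab : a ≠ b := fun h => hAB (((ha' a).2 rfl).symm.trans ((hb' a).2 h))
        rcases lt_or_gt_of_ne ((hinj i).ne hab) with hlt | hlt
        · left
          intro m m' hm hm'
          rwa [(ha' m).1 hm, (hb' m').1 hm']
        · right
          intro m m' hm hm'
          rwa [(hb' m).1 hm, (ha' m').1 hm'])
  rw [Fintype.card_fin] at hT
  -- The criterion is monotone in the family, so padding `T` to the exact size is harmless.
  obtain ⟨s, hTs, hs⟩ := Finset.exists_superset_card_eq hT (by rwa [Fintype.card_fin])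
  refine ⟨s, hs, ?_⟩
  refine iInter_convexHull_rays_eq_empty hp hp0 Prod.fst (t := fun x => t x.1 x.2)
    (fun x => ht _ _) c (hTs hA) (hTs hB) ⟨iA, hmiss _ _ hA0⟩ ⟨iB, hmiss _ _ hB0⟩ fun i => ?_
  rcases hcov i with ⟨j, hj, h⟩ | h
  · exact Or.inl ⟨j, hTs hj, hmiss _ _ h⟩
  · right
    rintro ⟨_, m⟩ ⟨i', m'⟩ rfl hi' hx hy
    obtain rfl : i' = _ := hi'
    exact h m m' hx hy

/-! ### Both bounds and the conclusion -/

/-- There is a `d`-simplex in `ℝ^d` whose vertices sum to `0`. -/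
theorem exists_affineIndependent_sum_eq_zero (d : ℕ) :
    ∃ p : Fin (d + 1) → EuclideanSpace ℝ (Fin d), AffineIndependent ℝ p ∧ ∑ i, p i = 0 := by
  obtain ⟨b⟩ : Nonempty (AffineBasis (Fin (d + 1)) ℝ (EuclideanSpace ℝ (Fin d))) :=
    AffineBasis.exists_affineBasis_of_finiteDimensional (by simp)
  let g := ((d + 1 : ℕ) : ℝ)⁻¹ • ∑ i, b i
  refine ⟨fun i => -g + b i, ?_, ?_⟩
  · exact (AffineEquiv.affineIndependent_iff
      (AffineEquiv.constVAdd ℝ (EuclideanSpace ℝ (Fin d)) (-g))).2 b.ind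
  · rw [Finset.sum_add_distrib, Finset.sum_const, Finset.card_univ, Fintype.card_fin,
      ← Nat.cast_smul_eq_nsmul ℝ, smul_neg, smul_inv_smul₀ (by positivity), neg_add_cancel]

/-- By Tverberg's theorem `(d + 1) (r - 1) + 1` points suffice for all the hulls to have a common point. -/
theorem reayProperty_tverbergNumber {d r k : ℕ} (hr : 0 < r) :
    ReayProperty d r k (tverbergNumber d r) := by
  obtain ⟨s, rfl⟩ : ∃ s, r = s + 1 := ⟨r - 1, by omega⟩
  intro a
  obtain ⟨c, z, hz⟩ := exists_tverberg_partition (s := s) (by simp [tverbergNumber]) a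
  rw [Set.mem_iInter] at hz
  refine ⟨c, fun j => ?_, fun T _ => ⟨z, Set.mem_iInter₂.2 fun j _ => hz j⟩⟩
  obtain ⟨_, i, hi, -⟩ := convexHull_nonempty_iff.1 ⟨z, hz j⟩
  exact ⟨i, hi⟩

/-- The partition property for `n` points passes to larger numbers of points. -/
theorem ReayProperty.mono {d r k n m : ℕ} (hr : 0 < r) (h : ReayProperty d r k n) (hnm : n ≤ m) :
    ReayProperty d r k m := by
  intro a
  obtain ⟨c, hc, hmeet⟩ := h fun i => a (Fin.castLE hnm i)
  let c' : Fin m → Fin r := fun i => if hi : (i : ℕ) < n then c ⟨i, hi⟩ else ⟨0, hr⟩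
  have hc' : ∀ i, c' (Fin.castLE hnm i) = c i := fun i => by simp [c']
  refine ⟨c', fun j => ?_, fun s hs => (hmeet s hs).mono ?_⟩
  · obtain ⟨i, hi⟩ := hc j
    exact ⟨Fin.castLE hnm i, (hc' i).trans hi⟩
  · refine Set.iInter₂_mono fun j _ => convexHull_mono ?_
    rintro _ ⟨i, hi, rfl⟩
    exact ⟨Fin.castLE hnm i, (hc' i).trans hi, rfl⟩

/-- Fewer than `(d + 1) (r - 1) + 1` points do not suffice for every `⌊(d + 3) / 2⌋` hulls to have
a common point. -/
theorem not_reayProperty_of_lt_tverbergNumber {d r n : ℕ} (hr : (d + 3) / 2 ≤ r)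
    (hn : n < tverbergNumber d r) : ¬ ReayProperty d r ((d + 3) / 2) n := by
  intro h
  have h' := h.mono (by omega) (Nat.lt_succ_iff.1 hn)
  obtain ⟨p, hp, hp0⟩ := exists_affineIndependent_sum_eq_zero d
  let t : Fin (d + 1) → Fin (r - 1) → ℝ := fun _ m => (m : ℝ) + 1
  obtain ⟨c, -, hmeet⟩ := h' fun i =>
    t (finProdFinEquiv.symm i).1 (finProdFinEquiv.symm i).2 • p (finProdFinEquiv.symm i).1
  obtain ⟨s, hs, hempty⟩ := exists_iInter_convexHull_rays_eq_empty hr hp hp0 (t := t)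
    (fun _ m => by positivity) (fun _ m m' hm => Fin.ext (by simpa [t] using hm))
    (fun x => c (finProdFinEquiv x))
  refine ((hmeet s hs).mono ?_).ne_empty hempty
  refine Set.iInter₂_mono fun j _ => convexHull_mono ?_
  rintro _ ⟨i, hi, rfl⟩
  exact ⟨finProdFinEquiv.symm i, by
    rwa [Set.mem_ofPred_eq, Equiv.apply_symm_apply], rfl⟩

theorem theorem2 (d r : ℕ) (hd : 3 ≤ d) (hr : (d + 3) / 2 ≤ r) :
    -- the minimum defining `T(d, r, ⌊(d+3)/2⌋)` is attained, and equals `T(d, r)`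
    IsLeast {n : ℕ | 0 < n ∧ ReayProperty d r ((d + 3) / 2) n} (reayNumber d r ((d + 3) / 2)) ∧
    reayNumber d r ((d + 3) / 2) = tverbergNumber d r ∧
    tverbergNumber d r = (d + 1) * (r - 1) + 1 ∧
    -- `r - 1` distinct points on each open ray from the centre `0` of a simplex to its vertices:
    -- in every `r`-partition some `⌊(d+3)/2⌋` parts have convex hulls with no common point
    (∀ p : Fin (d + 1) → EuclideanSpace ℝ (Fin d), AffineIndependent ℝ p → ∑ i, p i = 0 →
      ∀ t : Fin (d + 1) → Fin (r - 1) → ℝ, (∀ i m, 0 < t i m) →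
        (∀ i, Function.Injective (t i)) →
        ∀ c : Fin (d + 1) × Fin (r - 1) → Fin r, Function.Surjective c →
          ∃ s : Finset (Fin r), s.card = (d + 3) / 2 ∧
            (⋂ j ∈ s, convexHull ℝ
              ((fun x : Fin (d + 1) × Fin (r - 1) => t x.1 x.2 • p x.1) '' {x | c x = j})) = ∅) := by
  have hleast : IsLeast {n : ℕ | 0 < n ∧ ReayProperty d r ((d + 3) / 2) n}
      (tverbergNumber d r) :=
    ⟨⟨Nat.succ_pos _, reayProperty_tverbergNumber (by omega)⟩, fun n hn =>
      not_lt.1 fun hlt => not_reayProperty_of_lt_tverbergNumber hr hlt hn.2⟩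
  have heq : reayNumber d r ((d + 3) / 2) = tverbergNumber d r := hleast.csInf_eq
  exact ⟨heq ▸ hleast, heq, rfl, fun p hp hp0 t ht hinj c _ =>
    exists_iInter_convexHull_rays_eq_empty hr hp hp0 ht hinj c⟩
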